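/- Let $K\subset S^3$ be a tame knot, and fix an oriented diagram of $K$ with $n\ge 1$ crossings. Let $\Gamma_K$ be the knot group $\pi_1(S^3\setminus K)$, given by the Wirtinger presentation of this diagram: the generators are the arcs $x_1,\dots,x_n$ (indices mod $n$), and at the crossing where the arc $x_i$ ends and $x_{i+1}$ begins, under the arc $x_{j(i)}$, there is the relation $$(+)\quad x_i x_{j(i)}=x_{j(i)}x_{i+1}\qquad\text{or}\qquad(-)\quad x_{i+1}x_{j(i)}=x_{j(i)}x_i ,$$ according to whether the under-strand passes from left to right or from right to left of the over-strand. For a commutative ring $R$ and $t\in R$, let $A(t)\in \mathrm{Mat}_{n\times n}(R)$ be the matrix of the linear system with one equation for each crossing, $$(+)\quad (t-1)y_{j(i)}+y_i-ty_{i+1}=0\qquad\text{or}\qquad(-)\quad (t-1)y_{j(i)}-ty_i+y_{i+1}=0 .$$ Let $p$ be a prime. Let $\Delta_p(t)\in\mathbb F_p[t,t^{-1}]$ be the largest non-zero invariant factor of $A(t)$ over $\mathbb F_p[t,t^{-1}]$, which is defined up to units (it is a unit if $A(t)=0$). Let $\alpha\ne 0$ be a root of $\Delta_p(t)$ in a finite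 field $\mathbb F_{p^d}$ with $d=[\mathbb F_p(\alpha):\mathbb F_p]$, so that $\mathbb F_{p^d}=\mathbb F_p(\alpha)$. Let $\mathrm{Aff}(\mathbb F_{p^d})$ be the group, under composition, of the maps $z\mapsto az+b$ with $a\in\mathbb F_{p^d}^*$, $b\in\mathbb F_{p^d}$. A *de Rham representation attached to $\alpha$* is a homomorphism $\rho_\alpha:\Gamma_K\to\mathrm{Aff}(\mathbb F_{p^d})$ of the form $\rho_\alpha(x_k)=(z\mapsto\alpha z+y_k)$ for $1\le k\le n$, where $(y_1,\dots,y_n)\in\mathbb F_{p^d}^n$ lies in the kernel of $A(\alpha)$ and $y_1,\dots,y_n$ are not all equal. **Proposition 2.3.** A de Rham representation attached to $\alpha$ exists. For every de Rham representation $\rho_\alpha$ attached to $\alpha$, the image is the subgroup $$\rho_\alpha(\Gamma_K)=G_\alpha=\{\,z\mapsto\alpha^k z+b \;:\; k\in\mathbb Z,\ b\in\mathbb F_{p^d}\,\}\le \mathrm{Aff}(\mathbb F_{p^d}),$$ it is isomorphic to the semidirect product $\langle\alpha\rangle\ltimes\mathbb F_{p^d}$, in which $\langle\alpha\rangle\le\mathbb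 F_{p^d}^*$ acts on the additive group $\mathbb F_{p^d}$ by multiplication, and its order is $\mathrm{ord}(\alpha)\cdot p^d$, where $\mathrm{ord}(\alpha)$ is the order of $\alpha$ in $\mathbb F_{p^d}^*$. -/

import Mathlib

open scoped LaurentPolynomial IntermediateField

noncomputable section

/-- The signed Gauss code of an oriented closed curve with `n ≥ 1` transverse double points on a
closed oriented surface, with over/under information. Walking once around the curve from a base
point one meets `2 * n` passages, numbered by `Fin (2 * n)` in cyclic order. Crossings are numbered
in the order of their under-passages; `overPos i` and `underPos i` are the two passages of crossing `i`.
`ltr i = true` means that at crossing `i` the under-strand passes from the left to the right of the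
over-strand; `ltr i = false` means that it passes from right to left. -/
structure GaussDiagram where
  n : ℕ
  n_pos : 0 < n
  overPos : Fin n → Fin (2 * n)
  underPos : Fin n → Fin (2 * n)
  overPos_injective : Function.Injective overPos
  underPos_strictMono : StrictMono underPos
  overPos_ne_underPos : ∀ i k, overPos i ≠ underPos k
  ltr : Fin n → Bool

namespace GaussDiagram

/-- Edges of the underlying 4-valent graph are numbered by the passage at which they start; the edge
arriving at passage `q` is the one starting at the preceding passage. -/
def inEdge (D : GaussDiagram) (q : Fin (2 * D.n)) : Fin (2 * D.n) := (finRotate (2 * D.n)).symm q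

/-- `D.Corner u v`: keeping a face on the left hand, a walk along the directed edge `u` turns left at
the crossing that it reaches and goes on along the directed edge `v`. A directed edge is `(e, true)`
(along the orientation of the curve) or `(e, false)` (against it). Each crossing has four corners. -/
inductive Corner (D : GaussDiagram) : Fin (2 * D.n) × Bool → Fin (2 * D.n) × Bool → Prop
  | ltr_over_fwd (i : Fin D.n) (h : D.ltr i = true) :
      Corner D (D.inEdge (D.overPos i), true) (D.inEdge (D.underPos i), false)
  | ltr_over_bwd (i : Fin D.n) (h : D.ltr i = true) :
      Corner D (D.overPos i, false) (D.underPos i, true)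
  | ltr_under_fwd (i : Fin D.n) (h : D.ltr i = true) :
      Corner D (D.inEdge (D.underPos i), true) (D.overPos i, true)
  | ltr_under_bwd (i : Fin D.n) (h : D.ltr i = true) :
      Corner D (D.underPos i, false) (D.inEdge (D.overPos i), false)
  | rtl_over_fwd (i : Fin D.n) (h : D.ltr i = false) :
      Corner D (D.inEdge (D.overPos i), true) (D.underPos i, true)
  | rtl_over_bwd (i : Fin D.n) (h : D.ltr i = false) :
      Corner D (D.overPos i, false) (D.inEdge (D.underPos i), false)
  | rtl_under_fwd (i : Fin D.n) (h : D.ltr i = false) :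
      Corner D (D.inEdge (D.underPos i), true) (D.inEdge (D.overPos i), false)
  | rtl_under_bwd (i : Fin D.n) (h : D.ltr i = false) :
      Corner D (D.underPos i, false) (D.overPos i, true)

/-- The faces of the cellular surface carrying the curve: the cycles of directed edges under left
turns. -/
def Face (D : GaussDiagram) : Type := Quot D.Corner

/-- The carrying surface is the sphere: `V - E + F = n - 2 n + F = 2`. -/
def IsPlanar (D : GaussDiagram) : Prop := Nat.card D.Face = D.n + 2

end GaussDiagram

/-- A diagram, with at least one crossing, of an oriented knot in the 3-sphere. -/
structure KnotDiagram extends GaussDiagram where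
  planar : toGaussDiagram.IsPlanar

namespace KnotDiagram

/-- The cyclic successor `i + 1` of an index `i`. -/
def next (D : KnotDiagram) (i : Fin D.n) : Fin D.n := finRotate D.n i

/-- The arc containing a passage `q` that is not an under-passage. Arc `k` ends at under-passage `k`,
where arc `k + 1` begins; so `q` lies on arc `k` (modulo `n`) if exactly `k` under-passages
precede `q`. -/
def arc (D : KnotDiagram) (q : Fin (2 * D.n)) : Fin D.n :=
  ⟨(Finset.univ.filter fun k : Fin D.n => D.underPos k < q).card % D.n, Nat.mod_lt _ D.n_pos⟩

/-- `j i`: the arc passing over at crossing `i`, which is where arc `i` ends and `i + 1` begins. -/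
def j (D : KnotDiagram) (i : Fin D.n) : Fin D.n := D.arc (D.overPos i)

/-- The Wirtinger relators, `x_i x_{j(i)} = x_{j(i)} x_{i+1}` or
`x_{i+1} x_{j(i)} = x_{j(i)} x_i` according to the kind of crossing. -/
def relator (D : KnotDiagram) (i : Fin D.n) : FreeGroup (Fin D.n) :=
  if D.ltr i then
    (FreeGroup.of i * FreeGroup.of (D.j i)) * (FreeGroup.of (D.j i) * FreeGroup.of (D.next i))⁻¹
  else
    (FreeGroup.of (D.next i) * FreeGroup.of (D.j i)) * (FreeGroup.of (D.j i) * FreeGroup.of i)⁻¹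

/-- The knot group, by its Wirtinger presentation. -/
abbrev knotGroup (D : KnotDiagram) : Type := PresentedGroup (Set.range D.relator)

/-- The Wirtinger generator `x_k`. -/
def gen (D : KnotDiagram) (k : Fin D.n) : D.knotGroup := PresentedGroup.of k

/-- The matrix of the linear system
`(t - 1) y_{j(i)} + y_i - t y_{i+1} = 0`, or `(t - 1) y_{j(i)} - t y_i + y_{i+1} = 0`,
one row for each crossing `i`. -/
def deRhamMatrix (D : KnotDiagram) {R : Type*} [CommRing R] (t : R) :
    Matrix (Fin D.n) (Fin D.n) R :=
  Matrix.of fun i =>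
    if D.ltr i then Pi.single (D.j i) (t - 1) + Pi.single i 1 - Pi.single (D.next i) t
    else Pi.single (D.j i) (t - 1) - Pi.single i t + Pi.single (D.next i) 1

end KnotDiagram

/-- `δ` is the largest invariant factor of `A`: for some Smith normal form
`diag (e 0, e 1, …)`, `e 0 ∣ e 1 ∣ …`, of `A`, it is the last nonzero diagonal entry
(a unit if there is none). -/
def IsLargestInvariantFactor {R : Type*} [CommRing R] {n : ℕ} (A : Matrix (Fin n) (Fin n) R)
    (δ : R) : Prop :=
  ∃ (U V : (Matrix (Fin n) (Fin n) R)ˣ) (e : Fin n → R),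
    (U : Matrix (Fin n) (Fin n) R) * A * (V : Matrix (Fin n) (Fin n) R) = Matrix.diagonal e ∧
    (∀ i k, i ≤ k → e i ∣ e k) ∧
    ((∃ i, e i ≠ 0 ∧ (∀ k, i < k → e k = 0) ∧ δ = e i) ∨ ((∀ i, e i = 0) ∧ IsUnit δ))

namespace KnotDiagram

/-- `Δ` is (a representative, up to units, of) the polynomial `Δ_p(t)`: the largest invariant factor
of the matrix `A(t)` over `𝔽_p[t, t⁻¹]`. -/
def IsAlexanderPolynomialMod (D : KnotDiagram) (p : ℕ) (Δ : (ZMod p)[T;T⁻¹]) : Prop :=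
  IsLargestInvariantFactor (D.deRhamMatrix (LaurentPolynomial.T 1 : (ZMod p)[T;T⁻¹])) Δ

/-- `ρ` is a de Rham representation attached to `α`: `x_k ↦ (z ↦ α z + y_k)` for a vector `y` in the
kernel of `A(α)` that is not constant. (Constant vectors always lie in the kernel and give
abelian representations; after conjugation to `y_0 = 0`, `y` is non-constant iff it is nonzero.) -/
def IsDeRhamRep (D : KnotDiagram) {F : Type*} [Field F] (α : Fˣ)
    (ρ : D.knotGroup →* (F ≃ᵃ[F] F)) : Prop :=
  ∃ y : Fin D.n → F, (D.deRhamMatrix (α : F)).mulVec y = 0 ∧ (∃ i k, y i ≠ y k) ∧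
    ∀ k z, ρ (D.gen k) z = (α : F) * z + y k

end KnotDiagram

/-- The subgroup `G_α` of `Aff(F)`: all maps `z ↦ α ^ k z + b` with `k ∈ ℤ`, `b ∈ F`. -/
def affineGroup {F : Type*} [Field F] (α : Fˣ) : Subgroup (F ≃ᵃ[F] F) where
  carrier := {g | ∃ (k : ℤ) (b : F), ∀ z, g z = ((α ^ k : Fˣ) : F) * z + b}
  one_mem' := ⟨0, 0, fun z => by simp⟩
  mul_mem' := by
    rintro f g ⟨k, b, hf⟩ ⟨l, c, hg⟩
    refine ⟨k + l, ((α ^ k : Fˣ) : F) * c + b, fun z => ?_⟩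
    rw [AffineEquiv.mul_def, AffineEquiv.trans_apply, hg, hf, zpow_add, Units.val_mul]
    ring
  inv_mem' := by
    rintro f ⟨k, b, hf⟩
    refine ⟨-k, -(((α ^ (-k) : Fˣ) : F) * b), fun z => ?_⟩
    rw [AffineEquiv.inv_def, AffineEquiv.symm_apply_eq, hf, mul_add, mul_neg, ← mul_assoc,
      ← mul_assoc, ← Units.val_mul, ← zpow_add]
    simp

/-- The action of `⟨α⟩ ≤ Fˣ` on the additive group of `F` by multiplication. -/
def zpowersAction {F : Type*} [Field F] (α : Fˣ) :
    Subgroup.zpowers α →* MulAut (Multiplicative F) :=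
  ((MulAutMultiplicative F).symm.toMonoidHom.comp (DistribMulAction.toAddAut Fˣ F)).comp
    (Subgroup.zpowers α).subtype

end

/-!
A homomorphism with `x_k ↦ (z ↦ α z + y_k)` exists exactly for `y` in the kernel of `A(α)`, because
each Wirtinger relation becomes one row of the system `A(α) y = 0` (`toAffineHom`). So the
existence of a de Rham representation asks for a non-constant vector in this kernel.

The entries of each row of `A(t)` sum to zero, so `A(t)` kills the constant vectors over `𝔽_p[t, t⁻¹]`, and some
diagonal entry of its Smith normal form vanishes. The last nonzero entry vanishes at `α`, which gives
a second zero on the diagonal of the Smith form of `A(α)`. Hence the kernel of `A(α)` contains two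
different columns of an invertible matrix, and these are not both constant vectors
(`IsLargestInvariantFactor.exists_nonconstant_mulVec_eq_zero`).

The image of a de Rham representation lies in `G_α` because the generators go there. Conversely,
`ρ(x_i) ρ(x_k)⁻¹` is the translation by `y_i - y_k`, which is nonzero for some `i`, `k`; the
translations in the image form an additive group stable under multiplication by `α` (conjugate by
`ρ(x_0)`), that is, an `𝔽_p[α]`-submodule of the field `F = 𝔽_p(α)`, hence all of `F`
(`AddSubgroup.eq_top_of_mul_mem`). Together with one generator they give all of `G_α`, which is the
faithful image of the semidirect product (`semidirectToAffine`).
-/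

/-! ### The affine group of the line as a semidirect product -/

section AffineLine

variable {F : Type*} [Field F]

/-- The affine map `z ↦ u z + b` of the line. -/
def affineLineEquiv (u : Fˣ) (b : F) : F ≃ᵃ[F] F :=
  (LinearEquiv.smulOfUnit u).toAffineEquiv.trans (AffineEquiv.constVAdd F F b)

@[simp]
theorem affineLineEquiv_apply (u : Fˣ) (b z : F) : affineLineEquiv u b z = (u : F) * z + b := by
  change b + u • z = _
  rw [Units.smul_def, smul_eq_mul, add_comm]

theorem affineLineEquiv_mul (u v : Fˣ) (b c : F) :
    affineLineEquiv u b * affineLineEquiv v c = affineLineEquiv (u * v) (u * c + b) := by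
  ext z
  simp only [AffineEquiv.mul_def, AffineEquiv.trans_apply, affineLineEquiv_apply, Units.val_mul]
  ring

theorem affineLineEquiv_injective {u v : Fˣ} {b c : F}
    (h : affineLineEquiv u b = affineLineEquiv v c) : u = v ∧ b = c := by
  have h0 := DFunLike.congr_fun h 0
  have h1 := DFunLike.congr_fun h 1
  simp only [affineLineEquiv_apply, mul_zero, zero_add, mul_one] at h0 h1
  refine ⟨Units.ext ?_, h0⟩
  rw [h0] at h1
  exact add_right_cancel h1

theorem affineLineEquiv_inv (u : Fˣ) (b : F) :
    (affineLineEquiv u b)⁻¹ = affineLineEquiv u⁻¹ (-((u⁻¹ : Fˣ) * b)) := by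
  rw [inv_eq_iff_mul_eq_one, affineLineEquiv_mul]
  ext z
  simp

/-- The semidirect product `⟨α⟩ ⋉ F` acting on the line: `(b, u)` acts as `z ↦ u z + b`. -/
def semidirectToAffine (α : Fˣ) :
    Multiplicative F ⋊[zpowersAction α] Subgroup.zpowers α →* (F ≃ᵃ[F] F) :=
  MonoidHom.mk' (fun x => affineLineEquiv (x.right : Fˣ) x.left.toAdd) fun x y => by
    rw [affineLineEquiv_mul]
    congr 1
    rw [SemidirectProduct.mul_left, toAdd_mul, add_comm]
    rfl

theorem semidirectToAffine_injective (α : Fˣ) : Function.Injective (semidirectToAffine α) := by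
  intro x y h
  obtain ⟨hu, hb⟩ := affineLineEquiv_injective h
  exact SemidirectProduct.ext hb (Subtype.ext hu)

theorem mem_affineGroup_iff {α : Fˣ} {g : F ≃ᵃ[F] F} :
    g ∈ affineGroup α ↔ ∃ (k : ℤ) (b : F), g = affineLineEquiv (α ^ k) b := by
  refine exists_congr fun k => exists_congr fun b => ?_
  rw [AffineEquiv.ext_iff]
  simp only [affineLineEquiv_apply]

theorem range_semidirectToAffine (α : Fˣ) : (semidirectToAffine α).range = affineGroup α := by
  ext g
  rw [mem_affineGroup_iff]
  constructor
  · rintro ⟨⟨b, ⟨_, k, rfl⟩⟩, rfl⟩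
    exact ⟨k, b.toAdd, rfl⟩
  · rintro ⟨k, b, rfl⟩
    exact ⟨⟨Multiplicative.ofAdd b, ⟨α ^ k, k, rfl⟩⟩, rfl⟩

/-- The group `G_α` is generated by the translations and any one map `z ↦ α z + c`. -/
theorem affineGroup_le {α : Fˣ} {H : Subgroup (F ≃ᵃ[F] F)} (hT : ∀ b, affineLineEquiv 1 b ∈ H)
    {c : F} (hc : affineLineEquiv α c ∈ H) : affineGroup α ≤ H := by
  intro g hg
  obtain ⟨k, b, rfl⟩ := mem_affineGroup_iff.1 hg
  have hlin : ∀ m : ℤ, ∃ e, affineLineEquiv α c ^ m = affineLineEquiv (α ^ m) e := by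
    intro m
    induction m using Int.induction_on with
    | zero => exact ⟨0, by ext z; simp⟩
    | succ m ih =>
      obtain ⟨e, he⟩ := ih
      exact ⟨_, by rw [zpow_add_one, he, affineLineEquiv_mul, ← zpow_add_one]⟩
    | pred m ih =>
      obtain ⟨e, he⟩ := ih
      exact ⟨_, by rw [zpow_sub_one, he, affineLineEquiv_inv, affineLineEquiv_mul, ← zpow_sub_one]⟩
  obtain ⟨e, he⟩ := hlin k
  have := mul_mem (hT (b - e)) (he ▸ zpow_mem hc k)
  rwa [affineLineEquiv_mul, one_mul, Units.val_one, one_mul, add_sub_cancel] at this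

end AffineLine

/-! ### Additive subgroups stable under a generator of the field -/

theorem AddSubgroup.eq_top_of_mul_mem {p : ℕ} [Fact p.Prime] {F : Type*} [Field F]
    [Algebra (ZMod p) F] [Finite F] {a : F} (ha : (ZMod p)⟮a⟯ = ⊤) {S : AddSubgroup F}
    (hS : ∀ b ∈ S, a * b ∈ S) {b₀ : F} (hb₀ : b₀ ∈ S) (h0 : b₀ ≠ 0) : S = ⊤ := by
  have hadj : Algebra.adjoin (ZMod p) {a} = ⊤ := by
    rw [← IntermediateField.adjoin_simple_toSubalgebra_of_isAlgebraic
      (Algebra.IsAlgebraic.isAlgebraic a), ha, IntermediateField.top_toSubalgebra]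
  have hmul : ∀ c : F, ∀ b ∈ S, c * b ∈ S := by
    intro c
    have hc : c ∈ Algebra.adjoin (ZMod p) {a} := hadj ▸ Algebra.mem_top
    induction hc using Algebra.adjoin_induction with
    | mem x hx => obtain rfl := hx; exact hS
    | algebraMap r =>
      intro b hb
      rw [← Algebra.smul_def]
      exact ZMod.smul_mem hb r
    | add x y _ _ hx hy => intro b hb; rw [add_mul]; exact add_mem (hx b hb) (hy b hb)
    | mul x y _ _ hx hy => intro b hb; rw [mul_assoc]; exact hx _ (hy b hb)
  refine eq_top_iff.2 fun x _ => ?_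
  simpa [h0] using hmul (x / b₀) b₀ hb₀

theorem IntermediateField.adjoin_eq_top_of_natCard_eq {p : ℕ} [Fact p.Prime] {F : Type*} [Field F]
    [Algebra (ZMod p) F] [Finite F] {a : F} {d : ℕ} (hF : Nat.card F = p ^ d)
    (hd : Module.finrank (ZMod p) (ZMod p)⟮a⟯ = d) : (ZMod p)⟮a⟯ = ⊤ := by
  have hcard : Nat.card F = p ^ Module.finrank (ZMod p) F := by
    rw [Module.natCard_eq_pow_finrank (K := ZMod p), Nat.card_zmod]
  have hfin : d = Module.finrank (ZMod p) F :=
    Nat.pow_right_injective (Fact.out : p.Prime).two_le (hF.symm.trans hcard)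
  exact IntermediateField.eq_of_le_of_finrank_eq le_top
    (by rw [IntermediateField.finrank_top', hd, hfin])

/-! ### Kernels at a root of the largest invariant factor -/

/-- If a square matrix kills the constant vectors, then at a zero of its largest invariant factor it
also kills a non-constant vector. -/
theorem IsLargestInvariantFactor.exists_nonconstant_mulVec_eq_zero {R K : Type*} [CommRing R]
    [IsDomain R] [Field K] (f : R →+* K) {n : ℕ} (hn : 0 < n) {A : Matrix (Fin n) (Fin n) R}
    (hA : A.mulVec 1 = 0) {δ : R} (h : IsLargestInvariantFactor A δ) (hδ : f δ = 0) :
    ∃ y : Fin n → K, (A.map f).mulVec y = 0 ∧ ∃ i k, y i ≠ y k := by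
  obtain ⟨U, V, e, hUV, -, ⟨i, hi, -, rfl⟩ | ⟨-, hu⟩⟩ := h
  swap
  · exact absurd hδ (hu.map f).ne_zero
  -- The vector `V⁻¹ 1` is nonzero and is killed by the Smith form.
  obtain ⟨k, hk⟩ : ∃ k, e k = 0 := by
    set w := (↑V⁻¹ : Matrix (Fin n) (Fin n) R).mulVec 1 with hw
    have hVw : (V : Matrix (Fin n) (Fin n) R).mulVec w = 1 := by
      rw [hw, Matrix.mulVec_mulVec, Units.mul_inv, Matrix.one_mulVec]
    have hew : (Matrix.diagonal e).mulVec w = 0 := by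
      rw [← hUV, ← Matrix.mulVec_mulVec, hVw, ← Matrix.mulVec_mulVec, hA, Matrix.mulVec_zero]
    by_contra! hne
    have hw0 : w = 0 := by
      funext k
      have := congrFun hew k
      rw [Matrix.mulVec_diagonal] at this
      exact (mul_eq_zero.1 this).resolve_left (hne k)
    rw [hw0, Matrix.mulVec_zero] at hVw
    exact zero_ne_one (congrFun hVw ⟨0, hn⟩)
  have hik : i ≠ k := by rintro rfl; exact hi hk
  set U' := Units.map f.mapMatrix.toMonoidHom U
  set V' := Units.map f.mapMatrix.toMonoidHom V
  have hUV' : (U' : Matrix (Fin n) (Fin n) K) * A.map f * (V' : Matrix (Fin n) (Fin n) K)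
      = Matrix.diagonal (f ∘ e) := by
    have := congrArg f.mapMatrix hUV
    rw [map_mul, map_mul] at this
    rwa [RingHom.mapMatrix_apply _ (Matrix.diagonal e), Matrix.diagonal_map (map_zero f)] at this
  have hker : ∀ l, f (e l) = 0 →
      (A.map f).mulVec ((V' : Matrix (Fin n) (Fin n) K).mulVec (Pi.single l 1)) = 0 := by
    intro l hl
    have hz : ((U' : Matrix (Fin n) (Fin n) K) * A.map f * (V' : Matrix (Fin n) (Fin n) K)).mulVec
        (Pi.single l 1) = 0 := by
      rw [hUV', Matrix.mulVec_single_one]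
      funext m
      by_cases hm : m = l
      · subst hm; simp [hl]
      · simp [Matrix.diagonal_apply_ne _ hm]
    rw [mul_assoc, ← Matrix.mulVec_mulVec, ← Matrix.mulVec_mulVec] at hz
    have := congrArg (↑U'⁻¹ : Matrix (Fin n) (Fin n) K).mulVec hz
    rwa [Matrix.mulVec_mulVec, Units.inv_mul, Matrix.one_mulVec, Matrix.mulVec_zero] at this
  have hinj : Function.Injective (V' : Matrix (Fin n) (Fin n) K).mulVec :=
    Matrix.mulVec_injective_of_isUnit V'.isUnit
  by_contra! hcon
  -- Otherwise columns `i` and `k` of the invertible matrix are both constant, `c` and `c'`.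
  set z : Fin n := ⟨0, hn⟩
  have hci := fun m => hcon _ (hker i hδ) m z
  have hck := fun m => hcon _ (hker k (by rw [hk, map_zero])) m z
  set c := (V' : Matrix (Fin n) (Fin n) K).mulVec (Pi.single i 1) z
  set c' := (V' : Matrix (Fin n) (Fin n) K).mulVec (Pi.single k 1) z
  have hdep : c' • (Pi.single i 1 : Fin n → K) = c • (Pi.single k 1 : Fin n → K) := by
    apply hinj
    funext m
    rw [Matrix.mulVec_smul, Matrix.mulVec_smul, Pi.smul_apply, Pi.smul_apply, hci, hck, smul_eq_mul,
      smul_eq_mul, mul_comm]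
  have hc : c = 0 := by simpa [hik] using (congrFun hdep k).symm
  have hsingle : (Pi.single i 1 : Fin n → K) = 0 := by
    apply hinj
    funext m
    rw [hci, hc, Matrix.mulVec_zero, Pi.zero_apply]
  simpa using congrFun hsingle i

/-! ### De Rham representations -/

namespace KnotDiagram

variable (D : KnotDiagram)

theorem deRhamMatrix_mulVec {R : Type*} [CommRing R] (t : R) (y : Fin D.n → R) (i : Fin D.n) :
    (D.deRhamMatrix t).mulVec y i =
      if D.ltr i then (t - 1) * y (D.j i) + y i - t * y (D.next i)
      else (t - 1) * y (D.j i) - t * y i + y (D.next i) := by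
  change D.deRhamMatrix t i ⬝ᵥ y = _
  have hrow : D.deRhamMatrix t i =
    if D.ltr i then Pi.single (D.j i) (t - 1) + Pi.single i 1 - Pi.single (D.next i) t
    else Pi.single (D.j i) (t - 1) - Pi.single i t + Pi.single (D.next i) 1 := rfl
  rw [hrow]
  split_ifs <;> simp [add_dotProduct, sub_dotProduct]

theorem deRhamMatrix_mulVec_one {R : Type*} [CommRing R] (t : R) :
    (D.deRhamMatrix t).mulVec 1 = 0 := by
  funext i
  rw [deRhamMatrix_mulVec]
  simp only [Pi.one_apply, Pi.zero_apply]
  split_ifs <;> ring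

theorem deRhamMatrix_map {R S : Type*} [CommRing R] [CommRing S] (f : R →+* S) (t : R) :
    (D.deRhamMatrix t).map f = D.deRhamMatrix (f t) := by
  ext i k
  rw [Matrix.map_apply, deRhamMatrix, deRhamMatrix, Matrix.of_apply, Matrix.of_apply]
  split_ifs <;> simp [Pi.single_apply, apply_ite f]

variable {F : Type*} [Field F]

/-- The homomorphism `x_k ↦ (z ↦ α z + y_k)` of the knot group, for `y` in the kernel of `A(α)`. -/
def toAffineHom (α : Fˣ) (y : Fin D.n → F) (hy : (D.deRhamMatrix (α : F)).mulVec y = 0) :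
    D.knotGroup →* (F ≃ᵃ[F] F) :=
  PresentedGroup.toGroup (f := fun k => affineLineEquiv α (y k)) <| by
    rintro _ ⟨i, rfl⟩
    have hi := congrFun hy i
    rw [deRhamMatrix_mulVec, Pi.zero_apply] at hi
    rw [relator]
    split_ifs at hi ⊢ <;>
      simp only [map_mul, map_inv, FreeGroup.lift_apply_of, mul_inv_eq_one, affineLineEquiv_mul] <;>
      congr 1 <;> linear_combination hi

theorem toAffineHom_gen (α : Fˣ) (y : Fin D.n → F) (hy : (D.deRhamMatrix (α : F)).mulVec y = 0)
    (k : Fin D.n) : D.toAffineHom α y hy (D.gen k) = affineLineEquiv α (y k) :=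
  PresentedGroup.toGroup.of _

theorem range_le_affineGroup {α : Fˣ} {ρ : D.knotGroup →* (F ≃ᵃ[F] F)} {y : Fin D.n → F}
    (hρ : ∀ k, ρ (D.gen k) = affineLineEquiv α (y k)) : ρ.range ≤ affineGroup α := by
  rintro _ ⟨g, rfl⟩
  refine PresentedGroup.generated_by _ ((affineGroup α).comap ρ) (fun k => ?_) g
  exact mem_affineGroup_iff.2 ⟨1, y k, by rw [zpow_one]; exact hρ k⟩

theorem IsDeRhamRep.range_eq {D : KnotDiagram} {p : ℕ} [Fact p.Prime] [Algebra (ZMod p) F]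
    [Finite F] {α : Fˣ} (hα : (ZMod p)⟮(α : F)⟯ = ⊤) {ρ : D.knotGroup →* (F ≃ᵃ[F] F)}
    (h : D.IsDeRhamRep α ρ) : ρ.range = affineGroup α := by
  obtain ⟨y, -, ⟨i, k, hik⟩, hy⟩ := h
  have hρ : ∀ k, ρ (D.gen k) = affineLineEquiv α (y k) := fun k => by
    ext z; rw [hy, affineLineEquiv_apply]
  have hgen : ∀ k, affineLineEquiv α (y k) ∈ ρ.range := fun k => ⟨D.gen k, hρ k⟩
  refine le_antisymm (D.range_le_affineGroup hρ) (affineGroup_le ?_ (hgen i))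
  let S : AddSubgroup F :=
    { carrier := {b | affineLineEquiv 1 b ∈ ρ.range}
      zero_mem' := ⟨1, by rw [map_one]; ext z; simp⟩
      add_mem' := fun {a b} (ha : _ ∈ ρ.range) (hb : _ ∈ ρ.range) =>
        show _ ∈ ρ.range by simpa [affineLineEquiv_mul, -MonoidHom.mem_range] using mul_mem hb ha
      neg_mem' := fun {a} (ha : _ ∈ ρ.range) =>
        show _ ∈ ρ.range by simpa [affineLineEquiv_inv, -MonoidHom.mem_range] using inv_mem ha }
  -- Conjugation by a generator multiplies the translation vector by `α`.
  have hS : ∀ b ∈ S, (α : F) * b ∈ S := by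
    intro b (hb : _ ∈ ρ.range)
    have := mul_mem (mul_mem (hgen i) hb) (inv_mem (hgen i))
    rw [affineLineEquiv_inv, affineLineEquiv_mul, affineLineEquiv_mul] at this
    change _ ∈ ρ.range
    simpa [-MonoidHom.mem_range] using this
  have hd : y i - y k ∈ S := by
    have := mul_mem (hgen i) (inv_mem (hgen k))
    rw [affineLineEquiv_inv, affineLineEquiv_mul] at this
    change _ ∈ ρ.range
    simpa [-MonoidHom.mem_range, sub_eq_neg_add] using this
  have htop := AddSubgroup.eq_top_of_mul_mem hα hS hd (sub_ne_zero.2 hik)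
  exact fun b => (htop ▸ AddSubgroup.mem_top b : b ∈ S)

end KnotDiagram

theorem proposition2p3 (D : KnotDiagram) (p : ℕ) [Fact p.Prime] (d : ℕ)
    {F : Type*} [Field F] [Algebra (ZMod p) F] (hF : Nat.card F = p ^ d)
    (α : Fˣ) (hd : Module.finrank (ZMod p) (ZMod p)⟮(α : F)⟯ = d)
    (Δ : (ZMod p)[T;T⁻¹]) (hΔ : D.IsAlexanderPolynomialMod p Δ)
    (hα : LaurentPolynomial.eval₂ (algebraMap (ZMod p) F) α Δ = 0) :
    (∃ ρ : D.knotGroup →* (F ≃ᵃ[F] F), D.IsDeRhamRep α ρ) ∧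
    ∀ ρ : D.knotGroup →* (F ≃ᵃ[F] F), D.IsDeRhamRep α ρ →
      ρ.range = affineGroup α ∧
      Nonempty (ρ.range ≃* Multiplicative F ⋊[zpowersAction α] Subgroup.zpowers α) ∧
      Nat.card ρ.range = orderOf α * p ^ d := by
  have : Finite F := Nat.finite_of_card_ne_zero (hF ▸ pow_ne_zero d (Fact.out : p.Prime).ne_zero)
  refine ⟨?_, fun ρ hρ => ?_⟩
  · obtain ⟨y, hy, hne⟩ := hΔ.exists_nonconstant_mulVec_eq_zero _ D.n_pos
      (D.deRhamMatrix_mulVec_one _) hα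
    rw [D.deRhamMatrix_map, LaurentPolynomial.eval₂_T, zpow_one] at hy
    exact ⟨D.toAffineHom α y hy, y, hy, hne, fun k z => by
      rw [D.toAffineHom_gen, affineLineEquiv_apply]⟩
  · have hr := hρ.range_eq (IntermediateField.adjoin_eq_top_of_natCard_eq hF hd)
    have e : ρ.range ≃* Multiplicative F ⋊[zpowersAction α] Subgroup.zpowers α :=
      (MulEquiv.subgroupCongr (hr.trans (range_semidirectToAffine α).symm)).trans
        (MonoidHom.ofInjective (semidirectToAffine_injective α)).symm
    refine ⟨hr, ⟨e⟩, ?_⟩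
    rw [Nat.card_congr e.toEquiv, SemidirectProduct.card, Nat.card_zpowers, mul_comm, ← hF]
    rfl
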